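/- Let $D=(V,E)$ be a finite strongly connected digraph, let $P$ (pebbles) and $H$ (holes) be finite sets of labels with $|V|=|P|+|H|$, and let $\mathcal G(D)$ be the underlying undirected graph of $D$ (ignore the orientations of the edges). Assume that $|H|\ge 2$ and that $\mathcal G(D)$ is not a cycle (with at least three vertices). A (valid) configuration is a bijection $\mathcal A:P\cup H\to V$, and $\mathcal A[u,v]$ denotes the configuration obtained from $\mathcal A$ by exchanging the labels placed at $u$ and $v$. On $D$, a move $u\to v$ is allowed at $\mathcal A$ iff $(u,v)\in E$ and $v$ is occupied by a hole, and it leads to $\mathcal A[u,v]$. A plan is a finite, possibly empty, sequence of moves. An instance $(\mathcal A^s,\mathcal A^t)$ of multi-agent path finding (MAPF) on $D$ is *feasible* if there is a plan, all of whose moves are allowed in turn starting from $\mathcal A^s$, leading to a configuration $\mathcal B$ with $\mathcal B(p)=\mathcal A^t(p)$ for every $p\in P$. For a graph $G$ on $V$, the biconnected component tree $\mathcal T(G)$ is obtained from $G$ by replacing each maximal biconnected subgraph $S=(V_S,E_S)$ with at least three vertices by a star: the edges in $E_S$ are removed, a new *trans-shipment vertex* $s$ is added, and $s$ is joined to every vertex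 of $V_S$. Trans-shipment vertices carry neither pebbles nor holes, so the configurations on $\mathcal T(G)$ are the same bijections $P\cup H\to V$. A plan on $\mathcal T(G)$ is a finite sequence of directed edges of $\mathcal T(G)$. A move $u\to v$ with $u,v\in V$ obeys the usual rule (allowed iff $u,v$ are adjacent in $\mathcal T(G)$ and $v$ is occupied by a hole; it leads to $\mathcal A[u,v]$). A move $u\to s$ into a trans-shipment vertex must be followed immediately by a move $s\to v$ out of it; the pair $(u\to s)(s\to v)$ is allowed iff $u$ and $v$ are adjacent to $s$ and $v$ is occupied by a hole, and it leads to $\mathcal A[u,v]$. The instance $(\mathcal A^s,\mathcal A^t)$ of pebble motion on trees (PMT) on $\mathcal T(G)$ is *feasible* if some plan on $\mathcal T(G)$ leads from $\mathcal A^s$ to a configuration that agrees with $\mathcal A^t$ on $P$. Then, for all configurations $\mathcal A^s,\mathcal A^t$, the MAPF instance $(\mathcal A^s,\mathcal A^t)$ on $D$ is feasible if and only if the corresponding PMT instance $(\mathcal A^s,\mathcal A^t)$ on $\mathcal T(\mathcal G(D))$ is feasible. -/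

import Mathlib

namespace PebbleMotion

section Configurations

variable {P H V : Type*}

/-- A valid configuration: every pebble label in `P` and every hole label in `H` is placed on a
vertex, one label per vertex, and all vertices are occupied (`|V| = |P| + |H|`). -/
abbrev Config (P H V : Type*) := (P ⊕ H) ≃ V

/-- The vertex `v` is empty, i.e. occupied by a hole. -/
def Config.IsFree (A : Config P H V) (v : V) : Prop := ∃ h : H, A (Sum.inr h) = v

/-- The configuration `A[u, v]`, obtained from `A` by exchanging the labels placed at `u`
and `v`. -/
noncomputable def Config.exchange (A : Config P H V) (u v : V) : Config P H V :=
  open Classical in A.trans (Equiv.swap u v)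

/-- `B` places every pebble where `A` does (the labels of the holes are irrelevant). -/
def Config.SamePebbles (A B : Config P H V) : Prop := ∀ p : P, A (Sum.inl p) = B (Sum.inl p)

end Configurations

section Digraphs

variable {P H V : Type*}

/-- The partial transition function of a digraph: the move `u → v` is defined iff `(u, v)` is an
edge and `v` is occupied by a hole, and then it exchanges the labels at `u` and `v`. -/
noncomputable def move (D : Digraph V) (A : Config P H V) (e : V × V) :
    Option (Config P H V) :=
  open Classical in if D.Adj e.1 e.2 ∧ A.IsFree e.2 then some (A.exchange e.1 e.2) else none

/-- Extension of the partial transition function to finite sequences of moves; the result is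
`none` as soon as one of the moves is undefined. -/
noncomputable def runPlan (D : Digraph V) : Config P H V → List (V × V) → Option (Config P H V)
  | A, [] => some A
  | A, e :: f => (move D A e).bind fun B => runPlan D B f

/-- The MAPF instance on `D` with initial configuration `As` and final configuration `At` is
feasible: some plan brings each pebble to its final position. -/
def MAPFFeasible (D : Digraph V) (As At : Config P H V) : Prop :=
  ∃ (f : List (V × V)) (B : Config P H V), runPlan D As f = some B ∧ B.SamePebbles At

/-- Any two vertices are joined by a directed path in each direction. -/
def StronglyConnected (D : Digraph V) : Prop :=
  ∀ v w : V, Relation.ReflTransGen D.Adj v w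

end Digraphs

section Graphs

variable {P H V : Type*}

/-- A graph is biconnected if it is connected and remains connected after the removal of any
single vertex (the empty graph, left over from a one-vertex graph, is allowed here). -/
def IsBiconnected {W : Type*} (G : SimpleGraph W) : Prop :=
  G.Connected ∧ ∀ w : W, (G.induce {x | x ≠ w}).Preconnected

/-- `S` is the vertex set of a maximal non-trivial (at least three vertices) biconnected component.
Maximal biconnected subgraphs are induced subgraphs, so they are given by their vertex sets. -/
def IsBlock (G : SimpleGraph V) (S : Set V) : Prop :=
  Maximal (fun S : Set V => 3 ≤ S.encard ∧ IsBiconnected (G.induce S)) S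

/-- The maximal non-trivial biconnected components, used as labels of the trans-shipment
vertices. -/
abbrev Block (G : SimpleGraph V) := {S : Set V // IsBlock G S}

/-- Adjacency in the biconnected component tree: the edges of `G` that lie in no non-trivial
biconnected component are kept, and every non-trivial biconnected component `S` is replaced by a
star whose leaves are the vertices of `S` and whose centre is a new trans-shipment vertex. -/
def BlockTreeAdj (G : SimpleGraph V) : V ⊕ Block G → V ⊕ Block G → Prop
  | Sum.inl u, Sum.inl v => G.Adj u v ∧ ¬ ∃ S : Block G, u ∈ S.1 ∧ v ∈ S.1
  | Sum.inl u, Sum.inr S => u ∈ S.1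
  | Sum.inr S, Sum.inl u => u ∈ S.1
  | Sum.inr _, Sum.inr _ => False

/-- The biconnected component tree of `G`. The vertices `Sum.inl v` are the vertices of `G`, the
vertices `Sum.inr S` are the trans-shipment vertices. -/
def blockTree (G : SimpleGraph V) : SimpleGraph (V ⊕ Block G) where
  Adj := BlockTreeAdj G
  symm := by
    constructor
    rintro (u | S) (v | T) h
    · exact ⟨h.1.symm, fun ⟨S, hu, hv⟩ => h.2 ⟨S, hv, hu⟩⟩
    · exact h
    · exact h
    · exact h
  loopless := by
    constructor
    rintro (u | S) h
    · exact G.loopless.irrefl u h.1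
    · exact h

/-- Execution of a plan (a finite sequence of directed edges) on the biconnected component tree.
Pebbles and holes occupy the vertices of `G` only. A move `u → v` between two vertices of `G`
follows the usual rule; a move `u → s` into a trans-shipment vertex must be followed immediately by
a move `s → v` out of it, and the two together exchange the labels at `u` and `v` provided that `v`
is occupied by a hole. Every other sequence is undefined (`none`). -/
noncomputable def runTreePlan (G : SimpleGraph V) : Config P H V →
    List ((V ⊕ Block G) × (V ⊕ Block G)) → Option (Config P H V)
  | A, [] => some A
  | A, (Sum.inl u, Sum.inl v) :: f =>
      open Classical in
      if (blockTree G).Adj (Sum.inl u) (Sum.inl v) ∧ A.IsFree v then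
        runTreePlan G (A.exchange u v) f
      else none
  | A, (Sum.inl u, Sum.inr s) :: (Sum.inr w, Sum.inl v) :: f =>
      open Classical in
      if w = s ∧ (blockTree G).Adj (Sum.inl u) (Sum.inr s) ∧
          (blockTree G).Adj (Sum.inr s) (Sum.inl v) ∧ A.IsFree v then
        runTreePlan G (A.exchange u v) f
      else none
  | _, _ => none

/-- The PMT instance on the biconnected component tree of `G` with initial configuration `As` and
final configuration `At` is feasible. -/
def PMTFeasible (G : SimpleGraph V) (As At : Config P H V) : Prop :=
  ∃ (f : List ((V ⊕ Block G) × (V ⊕ Block G))) (B : Config P H V),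
    runTreePlan G As f = some B ∧ B.SamePebbles At

/-- `G` is a cycle with at least three vertices. -/
def IsCycleGraph (G : SimpleGraph V) : Prop :=
  ∃ n : ℕ, 3 ≤ n ∧ Nonempty (G ≃g SimpleGraph.cycleGraph n)

end Graphs

end PebbleMotion

/-!
Why the tree decides feasibility.

*Orientation is irrelevant.* Sending a hole once around a closed directed walk permutes the
positions by a permutation depending on the walk only, so repeating the tour undoes every move
(`PlanReach.exchange_reverse`). On a strongly connected digraph feasibility is therefore an
equivalence relation, and pebbles may as well move along the underlying undirected graph `G`
(`MAPFFeasible.of_adj`). A move on `D` is a move on the tree, so it remains to realise on `G` a jump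
through a trans-shipment vertex.

*Two holes.* All labels other than two fixed holes `h₁`, `h₂` are treated as pebbles, and `Sim` is
the equivalence relation generated by the moves of these two holes. Steps commute with relabelling,
so whether two given labels can be exchanged depends only on the `Sim`-class of a configuration, and
whether two given positions can be exchanged depends only on the positions `x`, `t` of the holes
(`PosSwap`). If `t` is a neighbour of `x`, pebbles at two other neighbours of `x` can be exchanged on
the star they span (`PosSwap.star`). Exchangeability then spreads to the rest of a set `W` that
remains connected after the removal of any vertex other than `x` (`posSwap_of_connected`): if `m` is
known to be exchangeable and `u` is adjacent to `m`, the holes make a round trip that pushes the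
label of `m` to `u` while some other exchangeable label ends at a neighbour of `x`, and so `u` is
exchangeable too.

*Blocks.* Let `S` be biconnected with at least three vertices and a hole in `S`. If `S` is not the
whole vertex set, one hole is brought to some `s ∈ S` and the other to a neighbour `t ∉ S` of `s`,
with the pebbles in question still in `S`, and the above applies to `W = S ∪ {t}`. If `S` is
everything, then, `G` not being a cycle, some `x` has three neighbours, and `W` is the whole vertex
set. Either way, any two pebbles in `S` can be exchanged (`Sim.exchange_of_isBiconnected`). A jump
from `u` to a hole at `v` follows: the hole walks from `v` to `u` inside `S`, and the pebbles
displaced on the way are exchanged back (`Sim.jump_of_isBiconnected`).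
-/

namespace PebbleMotion

/-! ### Walks inside a set of vertices -/

section ReachIn

variable {V : Type*} {G : SimpleGraph V} {Z Z' : Set V} {u v w : V}

/-- `v` can be reached from `u` by a walk of `G` all of whose vertices lie in `Z`. The trivial walk
is always allowed, even if `u ∉ Z`. -/
def ReachIn (G : SimpleGraph V) (Z : Set V) : V → V → Prop :=
  Relation.ReflTransGen fun a b => G.Adj a b ∧ a ∈ Z ∧ b ∈ Z

theorem ReachIn.symm (h : ReachIn G Z u v) : ReachIn G Z v u :=
  haveI : Std.Symm fun a b => G.Adj a b ∧ a ∈ Z ∧ b ∈ Z :=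
    ⟨fun _ _ h => ⟨h.1.symm, h.2.2, h.2.1⟩⟩
  Std.Symm.symm (r := Relation.ReflTransGen fun a b => G.Adj a b ∧ a ∈ Z ∧ b ∈ Z) _ _ h

theorem ReachIn.mono (hZ : Z ⊆ Z') (h : ReachIn G Z u v) : ReachIn G Z' u v :=
  Relation.ReflTransGen.mono (fun _ _ h => ⟨h.1, hZ h.2.1, hZ h.2.2⟩) _ _ h

theorem ReachIn.mem (h : ReachIn G Z u v) (hu : u ∈ Z) : v ∈ Z := by
  induction h with
  | refl => exact hu
  | tail _ h _ => exact h.2.2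

theorem ReachIn.within_reachable (h : ReachIn G Z u v) :
    ReachIn G {z | ReachIn G Z u z} u v := by
  induction h with
  | refl => exact .refl
  | tail h₁ h₂ ih => exact ih.tail ⟨h₂.1, h₁, h₁.tail h₂⟩

theorem ReachIn.exists_exit {U : Set V} (h : ReachIn G Z u v) (hu : u ∈ U) (hv : v ∉ U) :
    ∃ a ∈ U, ∃ b ∈ Z, b ∉ U ∧ G.Adj a b := by
  induction h with
  | refl => exact absurd hu hv
  | @tail b c _ h ih =>
    by_cases hb : b ∈ U
    · exact ⟨b, hb, c, h.2.2, hv, h.1⟩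
    · exact ih hb

theorem reachIn_of_reachable_induce {a b : Z} (h : (G.induce Z).Reachable a b) :
    ReachIn G Z a b := by
  obtain ⟨p⟩ := h
  induction p with
  | nil => exact .refl
  | cons h _ ih => exact .head ⟨h, Subtype.property _, Subtype.property _⟩ ih

theorem reachIn_univ_of_connected (hG : G.Connected) (u v : V) : ReachIn G Set.univ u v := by
  obtain ⟨p⟩ := hG.preconnected u v
  induction p with
  | nil => exact .refl
  | cons h _ ih => exact .head ⟨h, trivial, trivial⟩ ih

theorem IsBiconnected.reachIn {S : Set V} (hS : IsBiconnected (G.induce S)) (hu : u ∈ S)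
    (hv : v ∈ S) : ReachIn G S u v :=
  reachIn_of_reachable_induce (hS.1.preconnected ⟨u, hu⟩ ⟨v, hv⟩)

theorem IsBiconnected.reachIn_diff {S : Set V} (hS : IsBiconnected (G.induce S)) (hw : w ∈ S)
    (hu : u ∈ S) (hv : v ∈ S) (huw : u ≠ w) (hvw : v ≠ w) : ReachIn G (S \ {w}) u v := by
  have h := hS.2 ⟨w, hw⟩ ⟨⟨u, hu⟩, fun h => huw (congrArg Subtype.val h)⟩
    ⟨⟨v, hv⟩, fun h => hvw (congrArg Subtype.val h)⟩
  obtain ⟨p⟩ := h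
  have key : ∀ {a b : {x : S | x ≠ ⟨w, hw⟩}},
      ((G.induce S).induce {x | x ≠ ⟨w, hw⟩}).Walk a b → ReachIn G (S \ {w}) a.1.1 b.1.1 := by
    intro a b p
    have hmem : ∀ a : {x : S | x ≠ ⟨w, hw⟩}, a.1.1 ∈ S \ {w} :=
      fun a => ⟨a.1.2, fun h => a.2 (Subtype.ext h)⟩
    induction p with
    | nil => exact .refl
    | cons h _ ih => exact .head ⟨h, hmem _, hmem _⟩ ih
  exact key p

/-- In a biconnected graph with at least three vertices every degree is at least two. -/
theorem IsBiconnected.exists_two_adj {S : Set V} (hS : IsBiconnected (G.induce S))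
    (h3 : 3 ≤ S.encard) (hu : u ∈ S) :
    ∃ a ∈ S, ∃ b ∈ S, a ≠ b ∧ G.Adj u a ∧ G.Adj u b := by
  have hex : ∀ a b : V, ∃ c ∈ S, c ≠ a ∧ c ≠ b := by
    intro a b
    by_contra! hcon
    have hsub : S ⊆ {a, b} := by
      intro c hc
      by_cases hca : c = a
      · exact Or.inl hca
      · exact Or.inr (hcon c hc hca)
    have := h3.trans ((Set.encard_le_encard hsub).trans (Set.encard_insert_le {b} a))
    rw [Set.encard_singleton] at this
    exact absurd this (by decide)
  obtain ⟨c, hc, hcu, -⟩ := hex u u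
  obtain ⟨a', rfl, a, ha, -, hua⟩ :=
    (hS.reachIn hu hc).exists_exit (U := {u}) rfl hcu
  obtain ⟨d, hd, hdu, hda⟩ := hex a' a
  obtain ⟨b', rfl, b, hb, -, hub⟩ :=
    (hS.reachIn_diff ha hu hd hua.ne hda).exists_exit (U := {a'}) rfl hdu
  exact ⟨a, ha, b, hb.1, fun h => hb.2 h.symm, hua, hub⟩

end ReachIn

/-! ### Moving two distinguished holes -/

section Sim

variable {P H V : Type*} {G : SimpleGraph V} {h₁ h₂ : P ⊕ H} {A B C : Config P H V} {x t u v w : V}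

theorem Config.exchange_of_ne {l : P ⊕ H} (hu : A l ≠ u) (hv : A l ≠ v) :
    A.exchange u v l = A l := by
  classical exact Equiv.swap_apply_of_ne_of_ne hu hv

theorem Config.exchange_of_eq_left {l : P ⊕ H} (hu : A l = u) : A.exchange u v l = v := by
  subst hu; classical exact Equiv.swap_apply_left _ _

theorem Config.exchange_of_eq_right {l : P ⊕ H} (hv : A l = v) : A.exchange u v l = u := by
  subst hv; classical exact Equiv.swap_apply_right _ _

theorem Config.exchange_comm : A.exchange u v = A.exchange v u := by
  simp only [Config.exchange, Equiv.swap_comm]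

theorem Config.exchange_self : A.exchange u u = A := by
  ext l; simp [Config.exchange]

theorem Config.exchange_exchange : (A.exchange u v).exchange u v = A := by
  ext l; simp [Config.exchange]

/-- Conjugating one exchange by another. -/
theorem Config.exchange_conj (huw : u ≠ w) (hvw : v ≠ w) :
    ((A.exchange u v).exchange v w).exchange u v = A.exchange u w := by
  classical
  have key : ∀ z, Equiv.swap u v (Equiv.swap v w (Equiv.swap u v z)) = Equiv.swap u w z := by
    intro z
    by_cases h1 : z = u <;> by_cases h2 : z = v <;> by_cases h3 : z = w <;>
      simp_all [Equiv.swap_apply_def] <;> grind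
  ext l
  simp only [Config.exchange, Equiv.trans_apply]
  convert key (A l)

/-- An elementary step: one of the two distinguished labels moves along an edge of `G`, or the two
distinguished labels trade places. -/
inductive HoleStep (G : SimpleGraph V) (h₁ h₂ : P ⊕ H) : Config P H V → Config P H V → Prop
  | left (A : Config P H V) (v : V) : G.Adj (A h₁) v → HoleStep G h₁ h₂ A (A.exchange (A h₁) v)
  | right (A : Config P H V) (v : V) : G.Adj (A h₂) v → HoleStep G h₁ h₂ A (A.exchange (A h₂) v)
  | trade (A : Config P H V) : HoleStep G h₁ h₂ A (A.exchange (A h₁) (A h₂))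

/-- The equivalence relation generated by the elementary steps of the holes `h₁` and `h₂`. All
other labels, including further holes, are treated as pebbles. -/
def Sim (G : SimpleGraph V) (h₁ h₂ : P ⊕ H) : Config P H V → Config P H V → Prop :=
  Relation.EqvGen (HoleStep G h₁ h₂)

theorem Sim.refl (A : Config P H V) : Sim G h₁ h₂ A A := Relation.EqvGen.refl A

theorem Sim.symm (h : Sim G h₁ h₂ A B) : Sim G h₁ h₂ B A := Relation.EqvGen.symm _ _ h

theorem Sim.trans (h : Sim G h₁ h₂ A B) (h' : Sim G h₁ h₂ B C) : Sim G h₁ h₂ A C :=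
  Relation.EqvGen.trans _ _ _ h h'

theorem Sim.comm (h : Sim G h₁ h₂ A B) : Sim G h₂ h₁ A B := by
  induction h with
  | rel _ _ h =>
    refine .rel _ _ ?_
    cases h with
    | left v h => exact .right _ v h
    | right v h => exact .left _ v h
    | trade => rw [Config.exchange_comm]; exact .trade _
  | refl => exact .refl _
  | symm _ _ _ ih => exact ih.symm
  | trans _ _ _ _ _ ih ih' => exact ih.trans ih'

theorem Sim.adj_left (hA : A h₁ = u) (h : G.Adj u v) : Sim G h₁ h₂ A (A.exchange u v) := by
  subst hA; exact .rel _ _ (.left _ _ h)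

theorem Sim.adj_right (hA : A h₂ = u) (h : G.Adj u v) : Sim G h₁ h₂ A (A.exchange u v) := by
  subst hA; exact .rel _ _ (.right _ _ h)

theorem Sim.trade (hA : A h₁ = u) (hA' : A h₂ = v) : Sim G h₁ h₂ A (A.exchange u v) := by
  subst hA hA'; exact .rel _ _ (.trade _)

/-- Steps commute with permutations of the labels that fix both holes. -/
theorem Sim.relabel (h : Sim G h₁ h₂ A B) (σ : Equiv.Perm (P ⊕ H)) (hσ₁ : σ h₁ = h₁)
    (hσ₂ : σ h₂ = h₂) : Sim G h₁ h₂ (σ.trans A) (σ.trans B) := by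
  induction h with
  | rel A _ h =>
    refine .rel _ _ ?_
    cases h with
    | left v h =>
      have := HoleStep.left (h₁ := h₁) (h₂ := h₂) (G := G) (σ.trans A) v (by simpa [hσ₁] using h)
      simp only [Equiv.trans_apply, hσ₁] at this
      exact this
    | right v h =>
      have := HoleStep.right (h₁ := h₁) (h₂ := h₂) (G := G) (σ.trans A) v (by simpa [hσ₂] using h)
      simp only [Equiv.trans_apply, hσ₂] at this
      exact this
    | trade =>
      have := HoleStep.trade (h₁ := h₁) (h₂ := h₂) (G := G) (σ.trans A)
      simp only [Equiv.trans_apply, hσ₁, hσ₂] at this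
      exact this
  | refl => exact .refl _
  | symm _ _ _ ih => exact ih.symm
  | trans _ _ _ _ _ ih ih' => exact ih.trans ih'

theorem Config.swap_trans [DecidableEq (P ⊕ H)] (A : Config P H V) (a b : P ⊕ H) :
    (Equiv.swap a b).trans A = A.exchange (A a) (A b) := by
  classical
  ext l
  simp only [Config.exchange, Equiv.trans_apply, Equiv.swap_apply_def]
  split_ifs <;> simp_all

/-- Whether two labels can be exchanged depends only on the equivalence class of the
configuration. -/
theorem Sim.exchange_labels {a b : P ⊕ H} (hAB : Sim G h₁ h₂ A B)
    (hA : Sim G h₁ h₂ A (A.exchange (A a) (A b)))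
    (ha₁ : a ≠ h₁) (ha₂ : a ≠ h₂) (hb₁ : b ≠ h₁) (hb₂ : b ≠ h₂) :
    Sim G h₁ h₂ B (B.exchange (B a) (B b)) := by
  classical
  have := hAB.relabel (Equiv.swap a b) (Equiv.swap_apply_of_ne_of_ne ha₁.symm hb₁.symm)
    (Equiv.swap_apply_of_ne_of_ne ha₂.symm hb₂.symm)
  rw [Config.swap_trans, Config.swap_trans] at this
  exact (hAB.symm.trans hA).trans this

/-- A single move of `h₁`, described by its effect on the labels. -/
theorem Sim.exists_move_left (A : Config P H V) {a v : V} (hA : A h₁ = a) (h : G.Adj a v) :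
    ∃ B, Sim G h₁ h₂ A B ∧ B h₁ = v ∧ (∀ l, A l = v → B l = a) ∧
      ∀ l, A l ≠ a → A l ≠ v → B l = A l :=
  ⟨A.exchange a v, .adj_left hA h, Config.exchange_of_eq_left hA,
    fun _ => Config.exchange_of_eq_right, fun _ => Config.exchange_of_ne⟩

theorem Sim.exists_move_right (A : Config P H V) {a v : V} (hA : A h₂ = a) (h : G.Adj a v) :
    ∃ B, Sim G h₁ h₂ A B ∧ B h₂ = v ∧ (∀ l, A l = v → B l = a) ∧
      ∀ l, A l ≠ a → A l ≠ v → B l = A l :=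
  ⟨A.exchange a v, .adj_right hA h, Config.exchange_of_eq_left hA,
    fun _ => Config.exchange_of_eq_right, fun _ => Config.exchange_of_ne⟩

/-- The hole `h₁` can follow any walk, disturbing only labels on that walk. -/
theorem Sim.exists_walk_left {Z : Set V} {a b : V} (hab : ReachIn G Z a b) (A : Config P H V)
    (hA : A h₁ = a) :
    ∃ B, Sim G h₁ h₂ A B ∧ B h₁ = b ∧ ∀ l, A l ∉ Z → B l = A l := by
  induction hab with
  | refl => exact ⟨A, .refl A, hA, fun _ _ => rfl⟩
  | tail _ h ih =>
    obtain ⟨B, hAB, hB, hBZ⟩ := ih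
    obtain ⟨C, hBC, hC, -, hCZ⟩ := Sim.exists_move_left (h₂ := h₂) B hB h.1
    refine ⟨C, hAB.trans hBC, hC, fun l hl => ?_⟩
    rw [hCZ, hBZ l hl]
    · rw [hBZ l hl]; rintro rfl; exact hl h.2.1
    · rw [hBZ l hl]; rintro rfl; exact hl h.2.2

theorem Sim.exists_walk_right {Z : Set V} {a b : V} (hab : ReachIn G Z a b) (A : Config P H V)
    (hA : A h₂ = a) :
    ∃ B, Sim G h₁ h₂ A B ∧ B h₂ = b ∧ ∀ l, A l ∉ Z → B l = A l := by
  obtain ⟨B, h, h'⟩ := Sim.exists_walk_left (h₂ := h₁) hab A hA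
  exact ⟨B, h.comm, h'⟩

theorem Config.mem_of_fixes_outside {Z : Set V} (h : ∀ l, A l ∉ Z → B l = A l) {l : P ⊕ H}
    (hl : A l ∈ Z) : B l ∈ Z := by
  by_contra hBl
  have h₁ : B (A.symm (B l)) = B l := by
    rw [h _ (by rwa [Equiv.apply_symm_apply]), Equiv.apply_symm_apply]
  have h₂ : A l = B l := by rw [← B.injective h₁, Equiv.apply_symm_apply, B.injective h₁]
  exact hBl (h₂ ▸ hl)

/-- The positions `u` and `w` can be exchanged in every configuration with the holes at `x`
and `t`. -/
def PosSwap (G : SimpleGraph V) (h₁ h₂ : P ⊕ H) (x t u w : V) : Prop :=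
  ∀ A : Config P H V, A h₁ = x → A h₂ = t → Sim G h₁ h₂ A (A.exchange u w)

/-- A single configuration suffices, since any two configurations with the same positions of the
holes differ by a permutation of the labels fixing the holes. -/
theorem PosSwap.of_exists (hx : A h₁ = x) (ht : A h₂ = t)
    (h : Sim G h₁ h₂ A (A.exchange u w)) : PosSwap G h₁ h₂ x t u w := by
  intro B hBx hBt
  have := h.relabel (B.trans A.symm) (by simp [hBx, ← hx]) (by simp [hBt, ← ht])
  have hB : (B.trans A.symm).trans A = B := by ext; simp
  have hB' : (B.trans A.symm).trans (A.exchange u w) = B.exchange u w := by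
    ext; simp [Config.exchange]
  rwa [hB, hB'] at this

theorem PosSwap.symm (h : PosSwap (P := P) (H := H) G h₁ h₂ x t u w) :
    PosSwap (P := P) (H := H) G h₁ h₂ x t w u :=
  fun A hx ht => Config.exchange_comm (A := A) ▸ h A hx ht

theorem PosSwap.trans (h : PosSwap (P := P) (H := H) G h₁ h₂ x t u v)
    (h' : PosSwap (P := P) (H := H) G h₁ h₂ x t v w)
    (hux : u ≠ x) (hut : u ≠ t) (hvx : v ≠ x) (hvt : v ≠ t) (hwx : w ≠ x) (hwt : w ≠ t) :
    PosSwap (P := P) (H := H) G h₁ h₂ x t u w := by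
  intro A hx ht
  by_cases huw : u = w
  · rw [huw, Config.exchange_self]; exact .refl A
  by_cases hvw : v = w
  · exact hvw ▸ h A hx ht
  have fixes : ∀ {B : Config P H V} {l z} {a b : V}, B l = z → a ≠ z → b ≠ z →
      B.exchange a b l = z := by
    intro B l z a b hB ha hb
    rw [Config.exchange_of_ne (by rw [hB]; exact ha.symm) (by rw [hB]; exact hb.symm), hB]
  rw [← Config.exchange_conj huw hvw]
  have hx₁ := fixes hx hux hvx
  have ht₁ := fixes ht hut hvt
  exact ((h A hx ht).trans (h' _ hx₁ ht₁)).trans (h _ (fixes hx₁ hvx hwx) (fixes ht₁ hvt hwt))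

/-- The conclusion drawn from a closed tour of the holes: if the labels at two exchangeable
positions `p` and `q` end up at `u` and `w`, then `u` and `w` are exchangeable as well. -/
theorem PosSwap.transport {p q : V} (h : PosSwap (P := P) (H := H) G h₁ h₂ x t p q)
    (hpx : p ≠ x) (hpt : p ≠ t) (hqx : q ≠ x) (hqt : q ≠ t)
    (hA : A h₁ = x) (hA' : A h₂ = t) (hB : B h₁ = x) (hB' : B h₂ = t)
    (hAB : Sim G h₁ h₂ A B) (hu : B (A.symm p) = u) (hw : B (A.symm q) = w) :
    PosSwap (P := P) (H := H) G h₁ h₂ x t u w := by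
  refine .of_exists hB hB' ?_
  have hne : ∀ {r : V} {l}, r ≠ A l → A.symm r ≠ l := by
    rintro r l hr rfl; exact hr (A.apply_symm_apply r).symm
  have := hAB.exchange_labels (a := A.symm p) (b := A.symm q)
    (by simpa using h A hA hA') (hne (hA ▸ hpx)) (hne (hA' ▸ hpt)) (hne (hA ▸ hqx))
    (hne (hA' ▸ hqt))
  rwa [hu, hw] at this

end Sim

/-! ### Exchanging pebbles with two holes -/

section Core

variable {P H V : Type*} {G : SimpleGraph V} {h₁ h₂ : P ⊕ H} {A B C : Config P H V} {x t u v w : V}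

/-- With the holes at `x` and `t`, the pebble at a neighbour `n` of `x` can jump to `t`
through `x`. -/
theorem Sim.jump {n : V} (hA : A h₁ = x) (hA' : A h₂ = t) (hxt : G.Adj x t) (hxn : G.Adj x n)
    (hnt : n ≠ t) :
    Sim G h₁ h₂ A (A.exchange t n) := by
  have e : ((A.exchange x n).exchange t x).exchange n x = A.exchange t n := by
    rw [Config.exchange_comm (u := n), Config.exchange_comm (A := A.exchange x n),
      Config.exchange_comm (A := A) (u := t), Config.exchange_comm (A := A) (u := x),
      Config.exchange_comm (u := x) (v := n), Config.exchange_conj hnt hxt.ne]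
  rw [← e]
  have f₂ : A.exchange x n h₂ = t := by
    rw [Config.exchange_of_ne, hA'] <;> rw [hA']
    exacts [hxt.ne', hnt.symm]
  have f₁ : A.exchange x n h₁ = n := Config.exchange_of_eq_left hA
  refine ((Sim.adj_left hA hxn).trans (.adj_right f₂ hxt.symm)).trans (.trade ?_ ?_)
  · rw [Config.exchange_of_ne, f₁] <;> rw [f₁]
    exacts [hnt, hxn.ne']
  · exact Config.exchange_of_eq_left f₂

/-- On a star with centre `x` and leaves `t`, `n`, `n'`, the holes at `x` and `t` allow the pebbles
at `n` and `n'` to be exchanged. -/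
theorem PosSwap.star {n n' : V} (hxt : G.Adj x t) (hn : G.Adj x n) (hn' : G.Adj x n') (hnt : n ≠ t)
    (hnt' : n' ≠ t) : PosSwap (P := P) (H := H) G h₁ h₂ x t n n' := by
  intro A hx ht
  by_cases hnn : n = n'
  · rw [hnn, Config.exchange_self]; exact .refl A
  have e : ((A.exchange t n).exchange n n').exchange n' t = A.exchange n n' := by
    classical
    have key : ∀ z, Equiv.swap n' t (Equiv.swap n n' (Equiv.swap t n z)) = Equiv.swap n n' z := by
      intro z
      simp only [Equiv.swap_apply_def]
      grind
    ext l
    simp only [Config.exchange, Equiv.trans_apply]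
    convert key (A l)
  rw [← e]
  have fixes : ∀ {B : Config P H V} {a b : V}, B h₁ = x → x ≠ a → x ≠ b →
      B.exchange a b h₁ = x := by
    intro B a b hB ha hb
    rw [Config.exchange_of_ne (by rwa [hB]) (by rwa [hB]), hB]
  have a₁ := fixes hx hxt.ne hn.ne
  have b₁ : A.exchange t n h₂ = n := Config.exchange_of_eq_left ht
  have a₂ := fixes a₁ hn.ne hn'.ne
  have b₂ : (A.exchange t n).exchange n n' h₂ = n' := Config.exchange_of_eq_left b₁
  exact ((Sim.jump hx ht hxt hn hnt).trans (.jump a₁ b₁ hn hn' (Ne.symm hnn))).trans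
    (.jump a₂ b₂ hn' hxt hnt'.symm)

/-- The inductive step when `u` has access to `x` off `m` and `t`: the hole at `x` makes a round
trip through `u` and `m` and carries the label at `m` to `u`. -/
theorem PosSwap.round_trip {Z₁ Z₂ : Set V} {e m n : V}
    (hem : PosSwap (P := P) (H := H) G h₁ h₂ x t e m)
    (hxe : G.Adj x e) (hxn : G.Adj x n) (hum : G.Adj u m)
    (h₁w : ReachIn G Z₁ e u) (h₂w : ReachIn G Z₂ m n)
    (hxt : x ≠ t) (het : e ≠ t) (hmx : m ≠ x) (hmt : m ≠ t) (hem' : e ≠ m) (hux : u ≠ x)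
    (hut : u ≠ t) (hun : u ≠ n) (hnt : n ≠ t)
    (hx₁ : x ∉ Z₁) (ht₁ : t ∉ Z₁) (hm₁ : m ∉ Z₁) (hx₂ : x ∉ Z₂) (ht₂ : t ∉ Z₂) (hu₂ : u ∉ Z₂)
    (A : Config P H V) (hA : A h₁ = x) (hA' : A h₂ = t) :
    PosSwap (P := P) (H := H) G h₁ h₂ x t n u := by
  obtain ⟨α, hα⟩ := A.surjective e
  obtain ⟨β, hβ⟩ := A.surjective m
  obtain ⟨A₁, s₁, f₁, g₁, k₁⟩ := Sim.exists_move_left (h₂ := h₂) A hA hxe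
  have α₁ : A₁ α = x := g₁ _ hα
  have t₁ : A₁ h₂ = t := by rw [k₁, hA'] <;> rw [hA']; exacts [hxt.symm, het.symm]
  have β₁ : A₁ β = m := by rw [k₁, hβ] <;> rw [hβ]; exacts [hmx, hem'.symm]
  obtain ⟨A₂, s₂, f₂, k₂⟩ := Sim.exists_walk_left (h₂ := h₂) h₁w A₁ f₁
  have α₂ : A₂ α = x := by rw [k₂, α₁]; rwa [α₁]
  have t₂ : A₂ h₂ = t := by rw [k₂, t₁]; rwa [t₁]
  have β₂ : A₂ β = m := by rw [k₂, β₁]; rwa [β₁]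
  obtain ⟨A₃, s₃, f₃, g₃, k₃⟩ := Sim.exists_move_left (h₂ := h₂) A₂ f₂ hum
  have β₃ : A₃ β = u := g₃ _ β₂
  have α₃ : A₃ α = x := by rw [k₃, α₂] <;> rw [α₂]; exacts [hux.symm, hmx.symm]
  have t₃ : A₃ h₂ = t := by rw [k₃, t₂] <;> rw [t₂]; exacts [hut.symm, hmt.symm]
  obtain ⟨A₄, s₄, f₄, k₄⟩ := Sim.exists_walk_left (h₂ := h₂) h₂w A₃ f₃
  have α₄ : A₄ α = x := by rw [k₄, α₃]; rwa [α₃]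
  have t₄ : A₄ h₂ = t := by rw [k₄, t₃]; rwa [t₃]
  have β₄ : A₄ β = u := by rw [k₄, β₃]; rwa [β₃]
  obtain ⟨A₅, s₅, f₅, g₅, k₅⟩ := Sim.exists_move_left (h₂ := h₂) A₄ f₄ hxn.symm
  have α₅ : A₅ α = n := g₅ _ α₄
  have t₅ : A₅ h₂ = t := by rw [k₅, t₄] <;> rw [t₄]; exacts [hnt.symm, hxt.symm]
  have β₅ : A₅ β = u := by rw [k₅, β₄] <;> rw [β₄]; exacts [hun, hux]
  refine hem.transport hxe.ne' het hmx hmt hA hA' f₅ t₅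
    ((((s₁.trans s₂).trans s₃).trans s₄).trans s₅) ?_ ?_
  · rw [← hα, Equiv.symm_apply_apply, α₅]
  · rw [← hβ, Equiv.symm_apply_apply, β₅]

/-- The inductive step when `u` has access only to `t`: the hole at `t` walks through `u` and `m` to
a neighbour `n` of `x`, after which both holes return; a second neighbour `n'` of `x` is not
disturbed. -/
theorem PosSwap.one_way_trip {Z₁ Z₂ : Set V} {y m n n' : V}
    (hem : PosSwap (P := P) (H := H) G h₁ h₂ x t n' m)
    (hty : G.Adj t y) (hxt : G.Adj x t) (hxn : G.Adj x n) (hxn' : G.Adj x n') (hum : G.Adj u m)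
    (h₁w : ReachIn G Z₁ y u) (h₂w : ReachIn G Z₂ m n)
    (hnt : n ≠ t) (hnt' : n' ≠ t) (hmx : m ≠ x) (hmt : m ≠ t) (hyx : y ≠ x) (hyn : y ≠ n')
    (hym : y ≠ m) (hux : u ≠ x) (hut : u ≠ t) (hun : u ≠ n) (hun' : u ≠ n') (hmn : m ≠ n')
    (hnn : n ≠ n')
    (hx₁ : x ∉ Z₁) (hm₁ : m ∉ Z₁) (hn₁ : n' ∉ Z₁) (hx₂ : x ∉ Z₂) (hu₂ : u ∉ Z₂) (hn₂ : n' ∉ Z₂)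
    (A : Config P H V) (hA : A h₁ = x) (hA' : A h₂ = t) :
    PosSwap (P := P) (H := H) G h₁ h₂ x t n' u := by
  obtain ⟨α, hα⟩ := A.surjective n'
  obtain ⟨β, hβ⟩ := A.surjective m
  obtain ⟨A₁, s₁, f₁, -, k₁⟩ := Sim.exists_move_right (h₁ := h₁) A hA' hty
  have α₁ : A₁ α = n' := by rw [k₁, hα] <;> rw [hα]; exacts [hnt', hyn.symm]
  have x₁ : A₁ h₁ = x := by rw [k₁, hA] <;> rw [hA]; exacts [hxt.ne, hyx.symm]
  have β₁ : A₁ β = m := by rw [k₁, hβ] <;> rw [hβ]; exacts [hmt, hym.symm]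
  obtain ⟨A₂, s₂, f₂, k₂⟩ := Sim.exists_walk_right (h₁ := h₁) h₁w A₁ f₁
  have α₂ : A₂ α = n' := by rw [k₂, α₁]; rwa [α₁]
  have x₂ : A₂ h₁ = x := by rw [k₂, x₁]; rwa [x₁]
  have β₂ : A₂ β = m := by rw [k₂, β₁]; rwa [β₁]
  obtain ⟨A₃, s₃, f₃, g₃, k₃⟩ := Sim.exists_move_right (h₁ := h₁) A₂ f₂ hum
  have β₃ : A₃ β = u := g₃ _ β₂
  have α₃ : A₃ α = n' := by rw [k₃, α₂] <;> rw [α₂]; exacts [hun'.symm, hmn.symm]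
  have x₃ : A₃ h₁ = x := by rw [k₃, x₂] <;> rw [x₂]; exacts [hux.symm, hmx.symm]
  obtain ⟨A₄, s₄, f₄, k₄⟩ := Sim.exists_walk_right (h₁ := h₁) h₂w A₃ f₃
  have α₄ : A₄ α = n' := by rw [k₄, α₃]; rwa [α₃]
  have x₄ : A₄ h₁ = x := by rw [k₄, x₃]; rwa [x₃]
  have β₄ : A₄ β = u := by rw [k₄, β₃]; rwa [β₃]
  obtain ⟨A₅, s₅, f₅, -, k₅⟩ := Sim.exists_move_left (h₂ := h₂) A₄ x₄ hxt
  have α₅ : A₅ α = n' := by rw [k₅, α₄] <;> rw [α₄]; exacts [hxn'.ne', hnt']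
  have n₅ : A₅ h₂ = n := by rw [k₅, f₄] <;> rw [f₄]; exacts [hxn.ne', hnt]
  have β₅ : A₅ β = u := by rw [k₅, β₄] <;> rw [β₄]; exacts [hux, hut]
  obtain ⟨A₆, s₆, f₆, -, k₆⟩ := Sim.exists_move_right (h₁ := h₁) A₅ n₅ hxn.symm
  have α₆ : A₆ α = n' := by rw [k₆, α₅] <;> rw [α₅]; exacts [hnn.symm, hxn'.ne']
  have t₆ : A₆ h₁ = t := by rw [k₆, f₅] <;> rw [f₅]; exacts [hnt.symm, hxt.ne']
  have β₆ : A₆ β = u := by rw [k₆, β₅] <;> rw [β₅]; exacts [hun, hux]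
  have s₇ := Sim.trade (G := G) t₆ f₆
  refine hem.transport hxn'.ne' hnt' hmx hmt hA hA' (Config.exchange_of_eq_left t₆)
    (Config.exchange_of_eq_right f₆)
    ((((((s₁.trans s₂).trans s₃).trans s₄).trans s₅).trans s₆).trans s₇) ?_ ?_
  · rw [← hα, Equiv.symm_apply_apply, Config.exchange_of_ne, α₆, hα] <;> rw [α₆]
    exacts [hnt', hxn'.ne']
  · rw [← hβ, Equiv.symm_apply_apply, Config.exchange_of_ne, β₆] <;> rw [β₆]
    exacts [hut, hux]

/-- Let the holes be at adjacent vertices `x`, `t` of `W`, where `x` has two further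
neighbours, and suppose that `W` stays connected after removing any vertex other than `x`. Then every
position of `W` is exchangeable with the neighbours of `x`. The proof grows the set of exchangeable
positions along walks starting at `x`. -/
theorem posSwap_of_connected {W : Set V} (hxW : x ∈ W) (htW : t ∈ W) (hxt : G.Adj x t)
    (hconn : ∀ u ∈ W, u ≠ t → ReachIn G (W \ {t}) x u)
    (hcut : ∀ m ∈ W, m ≠ x → m ≠ t → ∀ u ∈ W, u ≠ m → ReachIn G (W \ {m}) u x)
    (hdeg : ∃ a b, a ≠ b ∧ a ≠ t ∧ b ≠ t ∧ G.Adj x a ∧ G.Adj x b)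
    (A : Config P H V) (hA : A h₁ = x) (hA' : A h₂ = t)
    {u : V} (hu : u ∈ W) (hux : u ≠ x) (hut : u ≠ t) {n : V} (hxn : G.Adj x n) (hnt : n ≠ t) :
    PosSwap (P := P) (H := H) G h₁ h₂ x t n u := by
  -- `M` is the set of positions exchangeable with all neighbours of `x`.
  let M : Set V := {z | z ≠ x ∧ z ≠ t ∧
    ∀ n, G.Adj x n → n ≠ t → PosSwap (P := P) (H := H) G h₁ h₂ x t n z}
  have hNM : ∀ z, G.Adj x z → z ≠ t → z ∈ M := fun z hz hzt =>
    ⟨hz.ne', hzt, fun n hn hnt => .star hxt hn hz hnt hzt⟩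
  have hM_of : ∀ {z n}, z ≠ x → z ≠ t → G.Adj x n → n ≠ t →
      PosSwap (P := P) (H := H) G h₁ h₂ x t n z → z ∈ M := fun hzx hzt hn hnt h =>
    ⟨hzx, hzt, fun n' hn' hnt' => (PosSwap.star hxt hn' hn hnt' hnt).trans h hn'.ne' hnt'
      hn.ne' hnt hzx hzt⟩
  have hMM : ∀ {p q}, p ∈ M → q ∈ M → PosSwap (P := P) (H := H) G h₁ h₂ x t p q :=
    fun hp hq => (hp.2.2 n hxn hnt).symm.trans (hq.2.2 n hxn hnt) hp.1 hp.2.1 hxn.ne' hnt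
      hq.1 hq.2.1
  -- Every `z` is joined to a neighbour of `x` by a walk in `M` with no other neighbour of `x`.
  have key : ∀ z, ReachIn G (W \ {t}) x z → z = x ∨ z ∈ M ∧ ∃ n, G.Adj x n ∧ n ≠ t ∧
      ReachIn G (insert n {y | y ∈ M ∧ ¬ G.Adj x y}) z n := by
    intro z hz
    induction hz with
    | refl => exact Or.inl rfl
    | @tail m u _ hmu ih =>
      by_cases hux : u = x
      · exact Or.inl hux
      have hut : u ≠ t := hmu.2.2.2
      by_cases hxu : G.Adj x u
      · exact Or.inr ⟨hNM u hxu hut, u, hxu, hut, .refl⟩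
      obtain rfl | ⟨hm, n, hn, hnt, hmn⟩ := ih
      · exact absurd hmu.1 hxu
      have hsub : insert n {y | y ∈ M ∧ ¬ G.Adj x y} ⊆ M := by
        rintro y (rfl | hy)
        exacts [hNM _ hn hnt, hy.1]
      suffices huM : u ∈ M by
        refine Or.inr ⟨huM, n, hn, hnt, .head ⟨hmu.1.symm, Or.inr ⟨huM, hxu⟩, ?_⟩ hmn⟩
        exact hmn.symm.mem (Or.inl rfl)
      by_contra huM
      have hum : u ≠ m := fun h => huM (h ▸ hm)
      have hreach := hcut m hmu.2.1.1 hm.1 hm.2.1 u hmu.2.2.1 hum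
      let Z : Set V := W \ {x, t, m}
      have huZ : u ∈ Z := ⟨hmu.2.2.1, by simp [hux, hut, hum]⟩
      -- Leaving the part of `Z` around `u` on the way to `x`, off `m`, a walk meets `x` or `t` first.
      by_cases hcase : ∃ e, G.Adj x e ∧ ReachIn G Z u e
      · obtain ⟨e, hxe, hue⟩ := hcase
        obtain ⟨-, he⟩ := hue.mem huZ
        simp only [Set.mem_insert_iff, Set.mem_singleton_iff, not_or] at he
        refine huM (hM_of hux hut hn hnt ?_)
        refine PosSwap.round_trip (hMM (hNM e hxe he.2.1) hm) hxe hn hmu.1.symm hue.symm hmn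
          hxt.ne he.2.1 hm.1 hm.2.1 he.2.2 hux hut ?_ hnt ?_ ?_ ?_ ?_ ?_ ?_ A hA hA'
        · rintro rfl; exact hxu hn
        · simp [Z]
        · simp [Z]
        · simp [Z]
        · exact fun h => (hsub h).1 rfl
        · exact fun h => (hsub h).2.1 rfl
        · exact fun h => huM (hsub h)
      · push Not at hcase
        obtain ⟨y, hy, c, hc, hcU, hyc⟩ := hreach.exists_exit (U := {z | ReachIn G Z u z}) .refl
          fun h : ReachIn G Z u x => (h.mem huZ).2 (Or.inl rfl)
        have hyZ := ReachIn.mem hy huZ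
        have hct : c = t := by
          by_contra hct
          have hcx : c ≠ x := by
            rintro rfl; exact hcase y hyc.symm hy
          refine hcU (Relation.ReflTransGen.tail hy ⟨hyc, hyZ, hc.1, ?_⟩)
          rintro (h | h | h)
          exacts [hcx h, hct h, hc.2 h]
        subst hct
        obtain ⟨n', hn', hnt', hnn⟩ : ∃ n', G.Adj x n' ∧ n' ≠ c ∧ n ≠ n' := by
          obtain ⟨a, b, hab, hat, hbt, hxa, hxb⟩ := hdeg
          by_cases hna : n = a
          · exact ⟨b, hxb, hbt, hna ▸ hab⟩
          · exact ⟨a, hxa, hat, hna⟩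
        have hZn : n' ∉ insert n {y | y ∈ M ∧ ¬ G.Adj x y} := by
          rintro (h | h)
          exacts [hnn h.symm, h.2 hn']
        have hmn' : m ≠ n' := by
          rintro rfl
          exact hZn (hmn.symm.mem (Or.inl rfl))
        have hUZ : ∀ z, ReachIn G Z u z → z ∈ Z := fun z hz => hz.mem huZ
        refine huM (hM_of hux hut hn' hnt' ?_)
        refine PosSwap.one_way_trip (hMM (hNM n' hn' hnt') hm) hyc.symm hxt hn hn' hmu.1.symm
          (ReachIn.within_reachable hy).symm hmn hnt hnt' hm.1 hm.2.1 ?_ ?_ ?_ hux hut ?_ ?_ hmn'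
          hnn ?_ ?_ ?_ ?_ ?_ hZn A hA hA'
        · rintro rfl; exact hyZ.2 (Or.inl rfl)
        · rintro rfl; exact hcase _ hn' hy
        · rintro rfl; exact hyZ.2 (by simp)
        · rintro rfl; exact hxu hn
        · rintro rfl; exact hxu hn'
        · exact fun h => (hUZ _ h).2 (by simp)
        · exact fun h => (hUZ _ h).2 (by simp)
        · exact hcase n' hn'
        · exact fun h => (hsub h).1 rfl
        · exact fun h => huM (hsub h)
  exact ((key u (hconn u hu hut)).resolve_left hux).1.2.2 n hxn hnt

/-- The exchange property in terms of labels: under the hypotheses of `posSwap_of_connected`, any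
two pebbles in `W` can be exchanged. -/
theorem Sim.exchange_of_connected {W : Set V} (hxW : x ∈ W) (htW : t ∈ W) (hxt : G.Adj x t)
    (hconn : ∀ u ∈ W, u ≠ t → ReachIn G (W \ {t}) x u)
    (hcut : ∀ m ∈ W, m ≠ x → m ≠ t → ∀ u ∈ W, u ≠ m → ReachIn G (W \ {m}) u x)
    (hdeg : ∃ a b, a ≠ b ∧ a ≠ t ∧ b ≠ t ∧ G.Adj x a ∧ G.Adj x b)
    (hA : A h₁ = x) (hA' : A h₂ = t) {a b : P ⊕ H} (ha : A a ∈ W) (hb : A b ∈ W)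
    (ha₁ : a ≠ h₁) (ha₂ : a ≠ h₂) (hb₁ : b ≠ h₁) (hb₂ : b ≠ h₂) :
    Sim G h₁ h₂ A (A.exchange (A a) (A b)) := by
  have hne : ∀ {l l' : P ⊕ H} {z}, l ≠ l' → A l' = z → A l ≠ z := by
    rintro l l' z hl rfl h; exact hl (A.injective h)
  obtain ⟨n, -, -, hnt, -, hxn, -⟩ := id hdeg
  have h := fun {l : P ⊕ H} (hl : A l ∈ W) (hl₁ : l ≠ h₁) (hl₂ : l ≠ h₂) =>
    posSwap_of_connected (P := P) (H := H) hxW htW hxt hconn hcut hdeg A hA hA' hl (hne hl₁ hA)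
      (hne hl₂ hA') hxn hnt
  exact ((h ha ha₁ ha₂).symm.trans (h hb hb₁ hb₂) (hne ha₁ hA) (hne ha₂ hA') hxn.ne' hnt
    (hne hb₁ hA) (hne hb₂ hA')) A hA hA'

end Core

/-! ### Biconnected sets of vertices -/

section Biconnected

variable {P H V : Type*} {G : SimpleGraph V} {h₁ h₂ : P ⊕ H} {A B C : Config P H V} {x t u v w : V}

/-- A finite connected graph in which every vertex has at least two and no vertex has three
neighbours is a cycle. -/
theorem isCycleGraph_of_forall_two_adj [Finite V] (hG : G.Connected)
    (h2 : ∀ x, ∃ a b, a ≠ b ∧ G.Adj x a ∧ G.Adj x b)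
    (h3 : ∀ x a b c, a ≠ b → a ≠ c → b ≠ c → G.Adj x a → G.Adj x b → ¬ G.Adj x c) :
    IsCycleGraph G := by
  classical
  have := Fintype.ofFinite V
  have hN : ∀ x, ∃ a b, a ≠ b ∧ G.neighborSet x = {a, b} := by
    intro x
    obtain ⟨a, b, hab, ha, hb⟩ := h2 x
    refine ⟨a, b, hab, Set.ext fun c => ⟨fun hc => ?_, ?_⟩⟩
    · by_contra hcon
      simp only [Set.mem_insert_iff, Set.mem_singleton_iff, not_or] at hcon
      exact h3 x a b c hab (Ne.symm hcon.1) (Ne.symm hcon.2) ha hb hc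
    · rintro (rfl | rfl)
      exacts [ha, hb]
  have hcard : ∀ x, (G.neighborSet x).ncard = 2 := by
    intro x
    obtain ⟨a, b, hab, h⟩ := hN x
    rw [h, Set.ncard_pair hab]
  have hcyc : G.IsCycles := fun x _ => hcard x
  obtain ⟨x⟩ := hG.nonempty
  obtain ⟨a, -, -, hxa, -⟩ := h2 x
  obtain ⟨p, hp, hpv⟩ := hcyc.exists_cycle_toSubgraph_verts_eq_connectedComponentSupp
    (c := G.connectedComponentMk x) rfl ⟨a, hxa⟩
  have hsupp : ∀ y, y ∈ p.support := by
    intro y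
    rw [← SimpleGraph.Walk.mem_verts_toSubgraph, hpv]
    exact SimpleGraph.ConnectedComponent.sound (hG.preconnected y x)
  have hlen : p.length = Fintype.card V := by
    have hnd := hp.support_nodup
    have htail : ∀ y, y ∈ p.support.tail := fun y => by
      have := hsupp y
      rw [SimpleGraph.Walk.mem_support_iff] at this
      rcases this with rfl | h
      · exact SimpleGraph.Walk.end_mem_tail_support hp.not_nil
      · exact h
    have h1 : p.support.tail.toFinset = Finset.univ := by
      ext y; simp [htail y]
    have h2 := List.toFinset_card_of_nodup hnd
    rw [h1, Finset.card_univ, List.length_tail, SimpleGraph.Walk.length_support] at h2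
    omega
  have h3len := hp.three_le_length
  obtain ⟨f⟩ := (SimpleGraph.cycleGraph_isContained_iff (by omega)).2 ⟨x, p, hp, hlen⟩
  have hf : Function.Bijective f.toHom :=
    (Fintype.bijective_iff_injective_and_card _).2 ⟨f.injective, by simp⟩
  refine ⟨Fintype.card V, by omega, ⟨(?_ : SimpleGraph.cycleGraph _ ≃g G).symm⟩⟩
  refine ⟨Equiv.ofBijective _ hf, ?_⟩
  -- Both graphs are 2-regular, so the spanning copy of the cycle has no further edges.
  intro i j
  refine ⟨fun h => ?_, fun h => f.toHom.map_adj h⟩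
  have himg : f.toHom '' (SimpleGraph.cycleGraph (Fintype.card V)).neighborSet i =
      G.neighborSet (f.toHom i) := by
    refine Set.eq_of_subset_of_ncard_le ?_ ?_
    · rintro _ ⟨k, hk, rfl⟩
      exact f.toHom.map_adj hk
    · rw [hcard, Set.ncard_image_of_injective _ f.injective]
      obtain ⟨m, hm⟩ : ∃ m, Fintype.card V = m + 3 := ⟨Fintype.card V - 3, by omega⟩
      have hdeg : ∀ n (i : Fin n), n = m + 3 →
          2 ≤ ((SimpleGraph.cycleGraph n).neighborSet i).ncard := by
        rintro n i rfl
        rw [Set.ncard_eq_toFinset_card']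
        exact SimpleGraph.cycleGraph_degree_three_le.ge
      exact hdeg _ i hm
  have hj : f.toHom j ∈ G.neighborSet (f.toHom i) := h
  rw [← himg] at hj
  obtain ⟨k, hk, hkj⟩ := hj
  exact f.injective hkj ▸ hk

/-- The hole `h₂` approaches the biconnected set `S`, which contains the hole `h₁`; as soon as it is
adjacent to `S`, all pebbles of `S` become exchangeable. -/
theorem Sim.exchange_of_hole_outside {S : Set V} (hG : G.Connected)
    (hS : IsBiconnected (G.induce S)) (h3 : 3 ≤ S.encard) {a b : P ⊕ H}
    (ha₁ : a ≠ h₁) (ha₂ : a ≠ h₂) (hb₁ : b ≠ h₁) (hb₂ : b ≠ h₂)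
    (hA : A h₁ ∈ S) (hA' : A h₂ ∉ S) (ha : A a ∈ S) (hb : A b ∈ S) :
    Sim G h₁ h₂ A (A.exchange (A a) (A b)) := by
  have h := reachIn_univ_of_connected hG (A h₂) (A h₁)
  generalize hz : A h₂ = z at h hA'
  generalize hy : A h₁ = y at h hA
  have key : ∀ A : Config P H V, A h₁ ∈ S → A h₂ = z → A a ∈ S → A b ∈ S →
      Sim G h₁ h₂ A (A.exchange (A a) (A b)) := by
    clear hy hz ha hb
    induction h using Relation.ReflTransGen.head_induction_on with
    | refl => exact absurd hA hA'
    | @head t s hts _ ih =>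
      intro A hA hz ha hb
      by_cases hs : s ∈ S
      · obtain ⟨B, hAB, hB, hfix⟩ := Sim.exists_walk_left (h₂ := h₂) (hS.reachIn hA hs) A rfl
        have hB' : B h₂ = t := by rw [hfix, hz]; rwa [hz]
        have hcore : Sim G h₁ h₂ B (B.exchange (B a) (B b)) := by
          obtain ⟨n, hn, n', hn', hne, hsn, hsn'⟩ := hS.exists_two_adj h3 hs
          refine Sim.exchange_of_connected (W := insert t S) (Or.inr hs) (Or.inl rfl) hts.1.symm
            ?_ ?_ ⟨n, n', hne, ?_, ?_, hsn, hsn'⟩ hB hB'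
            (Or.inr (Config.mem_of_fixes_outside hfix ha))
            (Or.inr (Config.mem_of_fixes_outside hfix hb)) ha₁ ha₂ hb₁ hb₂
          · intro u hu hut
            refine (hS.reachIn hs (hu.resolve_left hut)).mono ?_
            exact fun r hr => ⟨Or.inr hr, fun h => hA' (h ▸ hr)⟩
          · intro m hm hms hmt u hu hum
            have hm : m ∈ S := hm.resolve_left hmt
            have hsub : S \ {m} ⊆ insert t S \ {m} := fun r hr => ⟨Or.inr hr.1, hr.2⟩
            rcases hu with rfl | hu
            · exact .single ⟨hts.1, ⟨Or.inl rfl, hum⟩, Or.inr hs, Ne.symm hms⟩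
            · exact (hS.reachIn_diff hm hu hs hum (Ne.symm hms)).mono hsub
          · rintro rfl; exact hA' hn
          · rintro rfl; exact hA' hn'
        exact hAB.symm.exchange_labels hcore ha₁ ha₂ hb₁ hb₂
      · obtain ⟨B, hAB, hB, -, hfix⟩ := Sim.exists_move_right (h₁ := h₁) A hz hts.1
        have hS' : ∀ l, A l ∈ S → B l = A l := fun l hl => by
          refine hfix l ?_ ?_ <;> rintro h <;> rw [h] at hl
          exacts [hA' hl, hs hl]
        have := ih hs B (by rwa [hS' _ hA]) hB (by rwa [hS' _ ha]) (by rwa [hS' _ hb])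
        exact hAB.symm.exchange_labels this ha₁ ha₂ hb₁ hb₂
  exact key A (hy ▸ hA) hz ha hb

/-- If one of two holes lies in a biconnected set `S`, then any two pebbles in `S` can be exchanged,
unless the whole graph is a cycle. -/
theorem Sim.exchange_of_isBiconnected [Finite V] {S : Set V} (hG : G.Connected)
    (hcycle : ¬ IsCycleGraph G) (hS : IsBiconnected (G.induce S)) (h3 : 3 ≤ S.encard)
    (h12 : h₁ ≠ h₂) {a b : P ⊕ H}
    (ha₁ : a ≠ h₁) (ha₂ : a ≠ h₂) (hb₁ : b ≠ h₁) (hb₂ : b ≠ h₂)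
    (hA : A h₁ ∈ S) (ha : A a ∈ S) (hb : A b ∈ S) :
    Sim G h₁ h₂ A (A.exchange (A a) (A b)) := by
  by_cases hA' : A h₂ ∈ S
  swap
  · exact .exchange_of_hole_outside hG hS h3 ha₁ ha₂ hb₁ hb₂ hA hA' ha hb
  by_cases hSu : ∃ z, z ∉ S
  · -- Move `h₁` out of `S` through a vertex `s`; the pebbles of `S` stay in `S`.
    obtain ⟨z, hz⟩ := hSu
    obtain ⟨s, hs, t, -, ht, hst⟩ := (reachIn_univ_of_connected hG (A h₁) z).exists_exit hA hz
    obtain ⟨B, hAB, hB, hfix⟩ := Sim.exists_walk_left (h₂ := h₂) (hS.reachIn hA hs) A rfl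
    obtain ⟨C, hBC, hC, -, hfix'⟩ := Sim.exists_move_left (h₂ := h₂) B hB hst
    have hmem : ∀ l, l ≠ h₁ → A l ∈ S → C l ∈ S := by
      intro l hl hlS
      have hBl := Config.mem_of_fixes_outside hfix hlS
      rw [hfix' l]
      · exact hBl
      · rw [← hB]; exact fun h => hl (B.injective h)
      · exact fun h => ht (h ▸ hBl)
    have := Sim.exchange_of_hole_outside (h₁ := h₂) (h₂ := h₁) hG hS h3 ha₂ ha₁ hb₂ hb₁
      (hmem _ h12.symm hA') (hC ▸ ht) (hmem _ ha₁ ha) (hmem _ hb₁ hb)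
    exact (hAB.trans hBC).symm.exchange_labels this.comm ha₁ ha₂ hb₁ hb₂
  · push Not at hSu
    obtain rfl : S = Set.univ := Set.eq_univ_of_forall hSu
    obtain ⟨x, t, n, n', htn, htn', hnn, hxt, hxn, hxn'⟩ : ∃ x t n n', t ≠ n ∧ t ≠ n' ∧ n ≠ n' ∧
        G.Adj x t ∧ G.Adj x n ∧ G.Adj x n' := by
      by_contra! hcon
      refine hcycle (isCycleGraph_of_forall_two_adj hG (fun x => ?_) hcon)
      obtain ⟨a, -, b, -, h⟩ := hS.exists_two_adj h3 (Set.mem_univ x)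
      exact ⟨a, b, h⟩
    obtain ⟨B, hAB, hB, -⟩ := Sim.exists_walk_left (h₂ := h₂) (hS.reachIn trivial trivial) A rfl
      (b := x)
    have hBx : B h₂ ≠ x := hB ▸ fun h => h12 (B.injective h).symm
    obtain ⟨C, hBC, hC, hfix⟩ := Sim.exists_walk_right (h₁ := h₁)
      (hS.reachIn_diff (Set.mem_univ x) trivial trivial hBx hxt.ne') B rfl
    have hC' : C h₁ = x := by rw [hfix, hB]; simp [hB]
    have := Sim.exchange_of_connected (W := Set.univ) trivial trivial hxt
      (fun u _ hut => hS.reachIn_diff (Set.mem_univ t) trivial trivial hxt.ne hut)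
      (fun m _ hmx _ u _ hum => hS.reachIn_diff (Set.mem_univ m) trivial trivial hum hmx.symm)
      ⟨n, n', hnn, htn.symm, htn'.symm, hxn, hxn'⟩ hC' hC (a := a) (b := b) trivial trivial
      ha₁ ha₂ hb₁ hb₂
    exact (hAB.trans hBC).symm.exchange_labels this ha₁ ha₂ hb₁ hb₂

/-- A hole and any other label in a biconnected set can trade places. The hole walks from `v` to
`u`, and the pebbles displaced on the way are exchanged back one by one. -/
theorem Sim.jump_of_isBiconnected [Finite V] {S : Set V} (hG : G.Connected)
    (hcycle : ¬ IsCycleGraph G) (hS : IsBiconnected (G.induce S)) (h3 : 3 ≤ S.encard)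
    (h12 : h₁ ≠ h₂) (hA : A h₁ = v) (hv : v ∈ S) (hu : u ∈ S) :
    Sim G h₁ h₂ A (A.exchange v u) := by
  have h := hS.reachIn hv hu
  clear hv
  induction h using Relation.ReflTransGen.head_induction_on generalizing A with
  | refl => rw [Config.exchange_self]; exact .refl A
  | @head v v' hvv _ ih =>
    by_cases hvu : v = u
    · rw [hvu, Config.exchange_self]; exact .refl A
    have s₁ := Sim.adj_left (h₂ := h₂) hA hvv.1
    by_cases hvu' : v' = u
    · exact hvu' ▸ s₁
    rw [← Config.exchange_conj hvu hvu']
    have s₂ := ih (A := A.exchange v v') (Config.exchange_of_eq_left hA)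
    set B := (A.exchange v v').exchange v' u with hB
    have hBu : B h₁ = u := Config.exchange_of_eq_left (Config.exchange_of_eq_left hA)
    refine (s₁.trans s₂).trans ?_
    by_cases h₂v : B h₂ = v
    · exact .adj_right h₂v hvv.1
    by_cases h₂v' : B h₂ = v'
    · rw [Config.exchange_comm]; exact .adj_right h₂v' hvv.1.symm
    obtain ⟨a, ha⟩ := B.surjective v
    obtain ⟨b, hb⟩ := B.surjective v'
    have := Sim.exchange_of_isBiconnected (A := B) (a := a) (b := b) hG hcycle hS h3 h12 ?_ ?_ ?_ ?_
      (hBu ▸ hu) (ha ▸ hvv.2.1) (hb ▸ hvv.2.2)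
    · rwa [ha, hb] at this
    · rintro rfl; exact hvu (ha.symm.trans hBu)
    · rintro rfl; exact h₂v ha
    · rintro rfl; exact hvu' (hb.symm.trans hBu)
    · rintro rfl; exact h₂v' hb

end Biconnected

/-! ### Reversibility of motion on a strongly connected digraph -/

section Reversal

variable {P H V : Type*} {D : Digraph V} {A A' B B' C : Config P H V} {u v : V}

theorem Config.SamePebbles.isFree (h : A.SamePebbles B) (hA : A.IsFree v) : B.IsFree v := by
  obtain ⟨k, rfl⟩ := hA
  rcases hl : B.symm (A (Sum.inr k)) with p | k'
  · have h₁ : B (Sum.inl p) = A (Sum.inr k) := by rw [← hl, Equiv.apply_symm_apply]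
    exact absurd (A.injective ((h p).trans h₁)) (by simp)
  · exact ⟨k', by rw [← hl, Equiv.apply_symm_apply]⟩

theorem Config.SamePebbles.exchange (h : A.SamePebbles B) :
    (A.exchange u v).SamePebbles (B.exchange u v) := fun p => by
  simp only [Config.exchange, Equiv.trans_apply, h p]

theorem Config.SamePebbles.symm (h : A.SamePebbles B) : B.SamePebbles A := fun p => (h p).symm

theorem Config.SamePebbles.trans (h : A.SamePebbles B) (h' : B.SamePebbles C) :
    A.SamePebbles C := fun p => (h p).trans (h' p)

/-- `B` is the exact result, hole labels included, of some plan on `D` starting at `A`. -/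
def PlanReach (D : Digraph V) (A B : Config P H V) : Prop :=
  ∃ f : List (V × V), runPlan D A f = some B

theorem move_eq_some_iff {e : V × V} :
    move D A e = some B ↔ (D.Adj e.1 e.2 ∧ A.IsFree e.2) ∧ A.exchange e.1 e.2 = B := by
  simp [move]

/-- Reachability by plans is the reflexive transitive closure of single moves. -/
theorem planReach_iff : PlanReach D A B ↔
    Relation.ReflTransGen
      (fun A B => ∃ u v, D.Adj u v ∧ A.IsFree v ∧ B = A.exchange u v) A B := by
  constructor
  · rintro ⟨f, hf⟩
    induction f generalizing A with
    | nil => cases hf; exact .refl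
    | cons e f ih =>
      obtain ⟨C, hC, hf⟩ := Option.bind_eq_some_iff.1 hf
      obtain ⟨⟨h₁, h₂⟩, rfl⟩ := move_eq_some_iff.1 hC
      exact .head ⟨e.1, e.2, h₁, h₂, rfl⟩ (ih hf)
  · intro h
    induction h using Relation.ReflTransGen.head_induction_on with
    | refl => exact ⟨[], rfl⟩
    | head h _ ih =>
      obtain ⟨u, v, h₁, h₂, rfl⟩ := h
      obtain ⟨f, hf⟩ := ih
      exact ⟨(u, v) :: f, Option.bind_eq_some_iff.2 ⟨_, move_eq_some_iff.2 ⟨⟨h₁, h₂⟩, rfl⟩, hf⟩⟩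

theorem PlanReach.refl (A : Config P H V) : PlanReach D A A := ⟨[], rfl⟩

theorem PlanReach.trans (h : PlanReach D A B) (h' : PlanReach D B C) : PlanReach D A C :=
  planReach_iff.2 ((planReach_iff.1 h).trans (planReach_iff.1 h'))

theorem PlanReach.of_adj (h : D.Adj u v) (hv : A.IsFree v) : PlanReach D A (A.exchange u v) :=
  planReach_iff.2 (.single ⟨u, v, h, hv, rfl⟩)

/-- Sending a hole backwards along a directed walk permutes the labels by a permutation of the
positions that depends on the walk only. -/
theorem exists_perm_of_reflTransGen {a b : V} (hab : Relation.ReflTransGen D.Adj a b) :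
    ∃ π : Equiv.Perm V, π b = a ∧
      ∀ (A : Config P H V) (h : H), A (Sum.inr h) = b → PlanReach D A (A.trans π) := by
  induction hab using Relation.ReflTransGen.head_induction_on with
  | refl => exact ⟨1, rfl, fun A _ _ => .refl A⟩
  | @head a c hac _ ih =>
    classical
    obtain ⟨π, hπ, hA⟩ := ih
    refine ⟨π.trans (Equiv.swap a c), by simp [hπ], fun A h hh => (hA A h hh).trans ?_⟩
    convert PlanReach.of_adj (A := A.trans π) hac ⟨h, by simp [hh, hπ]⟩ using 1
    rw [Config.exchange, Equiv.trans_assoc]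

/-- A move can be undone: continuing the hole along a closed walk applies a fixed permutation of the
positions, and repeating the tour brings every label back. -/
theorem PlanReach.exchange_reverse [Finite V] (hD : StronglyConnected D) (huv : D.Adj u v) {h : H}
    (hA : A (Sum.inr h) = v) : PlanReach D (A.exchange u v) A := by
  classical
  obtain ⟨π, hπ, hreach⟩ := exists_perm_of_reflTransGen (P := P) (H := H) (hD v u)
  let ρ : Equiv.Perm V := (Equiv.swap u v).trans π
  have hρv : ρ v = v := by simp [ρ, hπ]
  have step : ∀ A : Config P H V, A (Sum.inr h) = v →
      PlanReach D (A.exchange u v) (A.trans ρ) := by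
    intro A hA
    convert hreach (A.exchange u v) h (Config.exchange_of_eq_right hA) using 1
    simp only [Config.exchange, ρ, Equiv.trans_assoc]
  have tour : ∀ (n : ℕ) (A : Config P H V), A (Sum.inr h) = v →
      PlanReach D A (A.trans (ρ ^ n : Equiv.Perm V)) := by
    intro n
    induction n with
    | zero => exact fun A _ => .refl A
    | succ n ih =>
      intro A hA
      have := ih (A.trans ρ) (by simp [hA, hρv])
      rw [Equiv.trans_assoc] at this
      rw [pow_succ]
      exact ((PlanReach.of_adj huv ⟨h, hA⟩).trans (step A hA)).trans this
  have hlast := tour (orderOf ρ - 1) (A.trans ρ) (by simp [hA, hρv])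
  have hone : (A.trans ρ).trans (ρ ^ (orderOf ρ - 1) : Equiv.Perm V) = A := by
    have : ρ ^ (orderOf ρ - 1) * ρ = 1 := by
      rw [← pow_succ, Nat.sub_add_cancel (orderOf_pos ρ), pow_orderOf_eq_one]
    ext l
    exact congrArg (fun σ : Equiv.Perm V => σ (A l)) this
  rw [hone] at hlast
  exact (step A hA).trans hlast

theorem PlanReach.symm [Finite V] (hD : StronglyConnected D) (h : PlanReach D A B) :
    PlanReach D B A := by
  rw [planReach_iff] at h
  induction h with
  | refl => exact .refl _
  | tail _ h ih =>
    obtain ⟨u, v, huv, ⟨k, hk⟩, rfl⟩ := h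
    exact (PlanReach.exchange_reverse hD huv hk).trans ih

theorem PlanReach.exists_samePebbles (h : PlanReach D A B) (hA : A.SamePebbles A') :
    ∃ B', PlanReach D A' B' ∧ B.SamePebbles B' := by
  rw [planReach_iff] at h
  induction h with
  | refl => exact ⟨A', .refl _, hA⟩
  | tail _ h ih =>
    obtain ⟨u, v, huv, hv, rfl⟩ := h
    obtain ⟨B', h₁, h₂⟩ := ih
    exact ⟨_, h₁.trans (.of_adj huv (h₂.isFree hv)), h₂.exchange⟩

theorem mapfFeasible_iff :
    MAPFFeasible D A B ↔ ∃ C, PlanReach D A C ∧ C.SamePebbles B :=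
  ⟨fun ⟨f, C, h, h'⟩ => ⟨C, ⟨f, h⟩, h'⟩, fun ⟨C, ⟨f, h⟩, h'⟩ => ⟨f, C, h, h'⟩⟩

theorem MAPFFeasible.of_samePebbles (h : A.SamePebbles B) : MAPFFeasible D A B :=
  mapfFeasible_iff.2 ⟨A, .refl A, h⟩

theorem MAPFFeasible.trans (h : MAPFFeasible D A B) (h' : MAPFFeasible D B C) :
    MAPFFeasible D A C := by
  rw [mapfFeasible_iff] at *
  obtain ⟨B', h₁, h₂⟩ := h
  obtain ⟨C', h₃, h₄⟩ := h'
  obtain ⟨C'', h₅, h₆⟩ := h₃.exists_samePebbles h₂.symm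
  exact ⟨C'', h₁.trans h₅, h₆.symm.trans h₄⟩

theorem MAPFFeasible.symm [Finite V] (hD : StronglyConnected D) (h : MAPFFeasible D A B) :
    MAPFFeasible D B A := by
  rw [mapfFeasible_iff] at *
  obtain ⟨B', h₁, h₂⟩ := h
  obtain ⟨A', h₃, h₄⟩ := (h₁.symm hD).exists_samePebbles h₂
  exact ⟨A', h₃, h₄.symm⟩

/-- On a strongly connected digraph, the orientation of the edges does not affect feasibility. -/
theorem MAPFFeasible.of_adj [Finite V] (hD : StronglyConnected D)
    (huv : D.toSimpleGraphInclusive.Adj u v) (hv : A.IsFree v) :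
    MAPFFeasible D A (A.exchange u v) := by
  refine mapfFeasible_iff.2 ⟨_, ?_, fun _ => rfl⟩
  rcases huv.2 with h | h
  · exact .of_adj h hv
  · obtain ⟨k, hk⟩ := hv
    have := PlanReach.of_adj (A := A.exchange u v) h ⟨k, Config.exchange_of_eq_right hk⟩
    rw [Config.exchange_comm (u := v), Config.exchange_exchange] at this
    exact this.symm hD

theorem Sim.mapfFeasible [Finite V] (hD : StronglyConnected D) {k₁ k₂ : H}
    (h : Sim D.toSimpleGraphInclusive (Sum.inr k₁) (Sum.inr k₂) A B) : MAPFFeasible D A B := by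
  induction h with
  | rel A _ h =>
    cases h with
    | left v h => rw [Config.exchange_comm]; exact .of_adj hD h.symm ⟨k₁, rfl⟩
    | right v h => rw [Config.exchange_comm]; exact .of_adj hD h.symm ⟨k₂, rfl⟩
    | trade =>
      exact .of_samePebbles fun p => (Config.exchange_of_ne (by simp) (by simp)).symm
  | refl => exact .of_samePebbles fun _ => rfl
  | symm _ _ _ ih => exact ih.symm hD
  | trans _ _ _ _ _ ih ih' => exact ih.trans ih'

end Reversal

/-! ### Comparison with the biconnected component tree -/

section Comparison

variable {P H V : Type*} {D : Digraph V} {A B : Config P H V}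

theorem StronglyConnected.connected [Nonempty V] (hD : StronglyConnected D) :
    D.toSimpleGraphInclusive.Connected := by
  refine ⟨fun u v => ?_⟩
  induction hD u v with
  | refl => exact .refl _
  | @tail v w _ h ih =>
    by_cases hvw : v = w
    · exact hvw ▸ ih
    · exact ih.trans (SimpleGraph.Adj.reachable ⟨hvw, Or.inl h⟩)

/-- A move on `D` is a move on the tree, possibly through a trans-shipment vertex. -/
theorem exists_treePlan_of_runPlan {f : List (V × V)} (h : runPlan D A f = some B) :
    ∃ g, runTreePlan D.toSimpleGraphInclusive A g = some B := by
  induction f generalizing A with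
  | nil => exact ⟨[], by rw [runTreePlan]; exact h⟩
  | cons e f ih =>
    obtain ⟨C, hC, hf⟩ := Option.bind_eq_some_iff.1 h
    obtain ⟨⟨huv, hv⟩, rfl⟩ := move_eq_some_iff.1 hC
    obtain ⟨g, hg⟩ := ih hf
    obtain ⟨u, v⟩ := e
    by_cases hne : u = v
    · subst hne
      exact ⟨g, by rwa [Config.exchange_self] at hg⟩
    by_cases hS : ∃ S : Block D.toSimpleGraphInclusive, u ∈ S.1 ∧ v ∈ S.1
    · obtain ⟨S, hu, hv'⟩ := hS
      refine ⟨(.inl u, .inr S) :: (.inr S, .inl v) :: g, ?_⟩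
      rw [runTreePlan, if_pos ⟨rfl, hu, hv', hv⟩, hg]
    · refine ⟨(.inl u, .inl v) :: g, ?_⟩
      rw [runTreePlan, if_pos ⟨⟨⟨hne, Or.inl huv⟩, hS⟩, hv⟩, hg]

/-- Every move on the tree can be realised on `D`, up to the labels of the holes. -/
theorem mapfFeasible_of_runTreePlan [Finite V] [Finite H] (hD : StronglyConnected D)
    (hcycle : ¬ IsCycleGraph D.toSimpleGraphInclusive) (hH : 2 ≤ Nat.card H)
    {g : List ((V ⊕ Block D.toSimpleGraphInclusive) × (V ⊕ Block D.toSimpleGraphInclusive))}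
    (h : runTreePlan D.toSimpleGraphInclusive A g = some B) : MAPFFeasible D A B := by
  fun_induction runTreePlan D.toSimpleGraphInclusive A g with
  | case1 A => cases h; exact .of_samePebbles fun _ => rfl
  | case2 A u v f hadj ih =>
    exact (MAPFFeasible.of_adj hD hadj.1.1 hadj.2).trans (ih h)
  | case3 => cases h
  | case4 A u s w v f hadj ih =>
    refine MAPFFeasible.trans ?_ (ih h)
    obtain ⟨-, hu, hv, k₁, hk₁⟩ := hadj
    have : Nonempty V := ⟨v⟩
    have : Nontrivial H := Finite.one_lt_card_iff_nontrivial.1 hH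
    obtain ⟨k₂, hk⟩ := exists_ne k₁
    rw [Config.exchange_comm]
    exact (Sim.jump_of_isBiconnected hD.connected hcycle s.2.prop.2 s.2.prop.1
      (fun h => hk (Sum.inr_injective h).symm) hk₁ hv hu).mapfFeasible hD
  | case5 => cases h
  | case6 => cases h

end Comparison

end PebbleMotion

theorem mainTheorem2 {V P H : Type*} [Finite V] [Finite P] [Finite H]
    (D : Digraph V) (hD : PebbleMotion.StronglyConnected D)
    (hcycle : ¬ PebbleMotion.IsCycleGraph D.toSimpleGraphInclusive)
    (hH : 2 ≤ Nat.card H)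
    (As At : PebbleMotion.Config P H V) :
    PebbleMotion.MAPFFeasible D As At ↔
      PebbleMotion.PMTFeasible D.toSimpleGraphInclusive As At := by
  constructor
  · rintro ⟨f, B, hf, hB⟩
    obtain ⟨g, hg⟩ := PebbleMotion.exists_treePlan_of_runPlan hf
    exact ⟨g, B, hg, hB⟩
  · rintro ⟨g, B, hg, hB⟩
    exact (PebbleMotion.mapfFeasible_of_runTreePlan hD hcycle hH hg).trans (.of_samePebbles hB)
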